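/- Setting. Let $\mathbb F_q$ be a finite field, $\alpha$ a primitive element of it, and let $m,N,K\ge 1$ and $T,S,A,D_2\ge 0$ be integers with $S<N$ and $mN<q$. Let $g:\mathbb F_q^{a\times b}\to\mathbb F_q^{a'\times b'}$ be a map all of whose output entries are polynomials of total degree at most $D_2$ in the input entries. A master wants to compute $g(X_i)$, $1\le i\le mK$, for data matrices $X_1,\dots,X_{mK}\in\mathbb F_q^{a\times b}$, using $N$ workers. In folded Lagrange coded computing (FLCC) with folding parameter $m$ one fixes distinct points $\beta_1,\dots,\beta_{m(K+T)}\in\mathbb F_q$, none of which is among the evaluation points $1,\alpha,\dots,\alpha^{mN-1}$; the master draws matrices $Z_{mK+1},\dots,Z_{m(K+T)}\in\mathbb F_q^{a\times b}$ with independent uniform entries and forms $$u(z)=\sum_{j=1}^{mK}X_j\ell_j(z)+\sum_{j=mK+1}^{m(K+T)}Z_j\ell_j(z),\qquad \ell_j(z)=\prod_{l\ne j}\frac{z-\beta_l}{\beta_j-\beta_l}.$$ Worker $i\in\{1,\dots,N\}$ receives $u(\alpha^{m(i-1)}),\dots,u(\alpha^{mi-1})$ and is asked to return the values of $f=g\circ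 u$ at these $m$ points. The master decodes the answers separately for each entry of the output matrix; after having received the answers it may choose, for each entry, at most $e$ further points of $\mathbb F_q$ and evaluate that entry of $f$ there itself, without error. The scheme is $S$-resilient and $A$-secure with $e$ extra evaluations if there is such a decoder that outputs all $g(X_i)$ correctly for all data and masks, whenever at most $S$ workers return nothing and, at the same time, at most $A$ workers answer arbitrarily. It is $T$-private if the joint distribution of the shares of any at most $T$ workers does not depend on the data. Theorem. Put $$r=\frac{(K+T-\frac1m)D_2+1}{N-S},\qquad a(s)=\frac{s}{s+1}\Bigl(1-\frac{mr}{m-s+1}\Bigr),\qquad \tilde s=\frac{\sqrt{m(m+1)(m(1-r)+2)r}-(m+1)}{mr-1},$$ where $\tilde s=\frac m2$ (the continuous extension) if $mr=1$. Let $s^*$ be $\lceil\tilde s\rceil-1$ or $\lceil\tilde s\rceil$, whichever lies in $\{1,\dots,m\}$ and, if both do, gives the larger value of $a$. If $$\frac{A}{N-S}\le\frac{s^*}{s^*+1}\Bigl(1-\frac{mr}{m-s^*+1}\Bigr),$$ then FLCC is $S$-resilient and $A$-secure with $s^*-1$ extra evaluations per output entry, and $T$-private. -/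

import Mathlib

noncomputable section

/-- Folded Lagrange coded computing over the finite field `F`, with folding parameter `m`,
`N` workers, `m * K` data matrices of size `a × b` and `m * T` random mask matrices, for a
polynomial map `g` of degree at most `D` from `a × b` matrices to `a' × b'` matrices. -/
structure FLCC (F : Type*) [Field F] [Fintype F] (m N K T D a b a' b' : ℕ) where
  /-- The primitive element of `F` whose powers are the evaluation points. -/
  α : F
  primitive : IsPrimitiveRoot α (Fintype.card F - 1)
  card_lt : m * N < Fintype.card F
  /-- The interpolation points: `m * K` of them carry data, `m * T` carry masks. -/
  β : Fin (m * K) ⊕ Fin (m * T) → F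
  β_injective : Function.Injective β
  disjoint : ∀ i < m * N, ∀ j, α ^ i ≠ β j
  /-- The entries of the polynomial map to be computed. -/
  g : Fin a' → Fin b' → MvPolynomial (Fin a × Fin b) F
  g_degree : ∀ i j, (g i j).totalDegree ≤ D

namespace FLCC

variable {F : Type*} [Field F] [Fintype F] {m N K T D a b a' b' : ℕ}
  (P : FLCC F m N K T D a b a' b')

/-- The value `g(X)`. -/
def apply (X : Matrix (Fin a) (Fin b) F) : Matrix (Fin a') (Fin b') F :=
  Matrix.of fun i j => MvPolynomial.eval (fun p => X p.1 p.2) (P.g i j)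

open Classical in
/-- The value at `z` of the encoding polynomial: the matrix-valued Lagrange interpolation
polynomial through the data `X` and the masks `Z`. -/
def encode (X : Fin (m * K) → Matrix (Fin a) (Fin b) F)
    (Z : Fin (m * T) → Matrix (Fin a) (Fin b) F) (z : F) : Matrix (Fin a) (Fin b) F :=
  ∑ j : Fin (m * K) ⊕ Fin (m * T),
    (Lagrange.basis Finset.univ P.β j).eval z • Sum.elim X Z j

/-- The `l`-th evaluation point of worker `i`. -/
def point (i : Fin N) (l : Fin m) : F := P.α ^ (m * (i : ℕ) + (l : ℕ))

/-- The share sent to worker `i`: `m` evaluations of the encoding polynomial. -/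
def share (X : Fin (m * K) → Matrix (Fin a) (Fin b) F)
    (Z : Fin (m * T) → Matrix (Fin a) (Fin b) F) (i : Fin N) :
    Fin m → Matrix (Fin a) (Fin b) F :=
  fun l => P.encode X Z (P.point i l)

/-- The value at `z` of the composed polynomial `g ∘ u`, with `u` the encoding polynomial. -/
def composed (X : Fin (m * K) → Matrix (Fin a) (Fin b) F)
    (Z : Fin (m * T) → Matrix (Fin a) (Fin b) F) (z : F) : Matrix (Fin a') (Fin b') F :=
  P.apply (P.encode X Z z)

/-- What worker `i` has to return: `g` of each of the `m` matrices in its share. -/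
def result (X : Fin (m * K) → Matrix (Fin a) (Fin b) F)
    (Z : Fin (m * T) → Matrix (Fin a) (Fin b) F) (i : Fin N) :
    Fin m → Matrix (Fin a') (Fin b') F :=
  fun l => P.apply (P.share X Z i l)

/-- `Received S A honest y`: the family `y` of answers (`none` is a missing answer) can reach the
master when the honest answers are `honest`, at most `S` workers are stragglers, which return
nothing, and at most `A` workers are Byzantine, whose behaviour is arbitrary. -/
def Received {R : Type*} (S A : ℕ) (honest : Fin N → R) (y : Fin N → Option R) : Prop :=
  ∃ straggler byzantine : Finset (Fin N), straggler.card ≤ S ∧ byzantine.card ≤ A ∧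
    (∀ i, i ∉ straggler → i ∉ byzantine → y i = some (honest i)) ∧
    (∀ i ∈ straggler, i ∉ byzantine → y i = none)

/-- The decoder of the master for one entry of the output matrix. From the received word it
determines at most `e` points (repetitions are allowed) where it evaluates that entry of the
composed polynomial itself; from the received word and these `e` values it outputs that entry for
each of the data matrices. -/
structure EntryDecoder (F : Type*) (m N K e : ℕ) where
  extraPoints : (Fin N → Option (Fin m → F)) → Fin e → F
  output : (Fin N → Option (Fin m → F)) → (Fin e → F) → Fin (m * K) → F

/-- The word received for the entry `(i, j)` of the output matrix. -/
def entryWord (y : Fin N → Option (Fin m → Matrix (Fin a') (Fin b') F))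
    (i : Fin a') (j : Fin b') : Fin N → Option (Fin m → F) :=
  fun w => (y w).map fun M l => M l i j

/-- The scheme is `S`-resilient and `A`-secure, with at most `e` extra evaluations at the master
per entry: the master has an entrywise decoder that always outputs `g(X_1), …, g(X_{mK})`, with
up to `S` stragglers and up to `A` Byzantine workers at the same time. -/
def IsResilientSecure (S A e : ℕ) : Prop :=
  ∃ dec : EntryDecoder F m N K e,
    ∀ (X : Fin (m * K) → Matrix (Fin a) (Fin b) F)
      (Z : Fin (m * T) → Matrix (Fin a) (Fin b) F)
      (y : Fin N → Option (Fin m → Matrix (Fin a') (Fin b') F)),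
      Received S A (P.result X Z) y →
      ∀ (i : Fin a') (j : Fin b') (n : Fin (m * K)),
        dec.output (entryWord y i j)
          (fun t => P.composed X Z (dec.extraPoints (entryWord y i j) t) i j) n
        = P.apply (X n) i j

open Classical in
/-- The joint distribution of the shares of the workers in `C`, for the data `X` and masks whose
entries are independent and uniform. -/
def shareLaw (C : Finset (Fin N)) (X : Fin (m * K) → Matrix (Fin a) (Fin b) F) :
    PMF (C → Fin m → Matrix (Fin a) (Fin b) F) :=
  (PMF.uniformOfFintype (Fin (m * T) → Matrix (Fin a) (Fin b) F)).map
    fun Z w => P.share X Z w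

/-- `t`-privacy: the shares of any `t` or fewer colluding workers have a joint distribution that
does not depend on the data. -/
def IsPrivate (t : ℕ) : Prop :=
  ∀ C : Finset (Fin N), C.card ≤ t → ∀ X X', P.shareLaw C X = P.shareLaw C X'

end FLCC

/-- The modified rate. -/
def flccRate (m N K T S D : ℕ) : ℝ :=
  (((K : ℝ) + T - 1 / m) * D + 1) / ((N : ℝ) - S)

/-- The bound on the fraction of Byzantine workers, as a function of `s`. -/
def flccBound (m : ℕ) (r : ℝ) (s : ℕ) : ℝ :=
  (s : ℝ) / (s + 1) * (1 - m * r / ((m : ℝ) - s + 1))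

/-- The critical point of the bound over real `s`. At `m * r = 1` the closed form reads `0 / 0`,
and its continuous extension `m / 2` is the critical point. -/
def flccSTilde (m : ℕ) (r : ℝ) : ℝ :=
  if (m : ℝ) * r = 1 then (m : ℝ) / 2
  else (√((m : ℝ) * (m + 1) * (m * (1 - r) + 2) * r) - (m + 1)) / (m * r - 1)

/-- The elements of `{1, …, m}` among the two integers next to the critical point. -/
def flccCandidates (m : ℕ) (r : ℝ) : Set ℕ :=
  {s | 1 ≤ s ∧ s ≤ m ∧ ((s : ℤ) = ⌈flccSTilde m r⌉ - 1 ∨ (s : ℤ) = ⌈flccSTilde m r⌉)}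

/-- `s` is the candidate with the larger bound. -/
def IsFLCCSStar (m : ℕ) (r : ℝ) (s : ℕ) : Prop :=
  s ∈ flccCandidates m r ∧ ∀ s' ∈ flccCandidates m r, flccBound m r s' ≤ flccBound m r s

end

/-! Decoding: each entry `f` of `g ∘ u` is a polynomial of bounded degree, and the answers form a
corrupted folded Reed–Solomon word. Linear algebra gives `A₀ + ∑ B_j Y_j`, not zero, vanishing on
all windows of `s` consecutive received symbols. If `f` agrees with enough blocks, `A₀(x) + ∑ B_j(x)
f(c^j x)` has more zeros than its degree, so it is identically zero
(`exists_points_separating_candidates`). Differences of candidates solve the homogeneous equation,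
whose low-order recursion leaves at most `s - 1` coefficients free (`exists_determining_coeffs`).
Hence `s - 1` evaluation points, chosen from the received word alone, single out the true `f`.

Privacy: a change of data can be compensated on any `T` workers by translating the masks, which
preserves the uniform law (`exists_masks_share_eq_zero`). -/

/-! ### Linear functional equations and determining points -/

open Polynomial in
/-- A homogeneous linear interpolation problem with fewer constraints than coefficients has a
nontrivial solution. -/
theorem exists_linear_interpolant {F ι : Type*} [Field F] [Fintype ι] (s p q : ℕ)
    (x : ι → F) (v : ι → Fin s → F) (hcard : Fintype.card ι < p + s * q) :
    ∃ (A₀ : F[X]) (A : Fin s → F[X]), A₀.degree < p ∧ (∀ j, (A j).degree < q) ∧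
      (A₀ ≠ 0 ∨ A ≠ 0) ∧ ∀ i, A₀.eval (x i) + ∑ j, (A j).eval (x i) * v i j = 0 := by
  let e : (degreeLT F p × (Fin s → degreeLT F q)) ≃ₗ[F] (Fin p → F) × (Fin s → Fin q → F) :=
    (degreeLTEquiv F p).prodCongr (LinearEquiv.piCongrRight fun _ => degreeLTEquiv F q)
  have : FiniteDimensional F (degreeLT F p × (Fin s → degreeLT F q)) := e.symm.finiteDimensional
  have hV : Module.finrank F (degreeLT F p × (Fin s → degreeLT F q)) = p + s * q := by
    rw [e.finrank_eq, Module.finrank_prod]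
    simp [Module.finrank_pi_fintype]
  let φ : (degreeLT F p × (Fin s → degreeLT F q)) →ₗ[F] (ι → F) :=
    { toFun := fun a i => (a.1 : F[X]).eval (x i) + ∑ j, (a.2 j : F[X]).eval (x i) * v i j
      map_add' := by
        intro a b
        ext i
        simp only [Prod.fst_add, Prod.snd_add, Pi.add_apply, Submodule.coe_add, eval_add, add_mul,
          Finset.sum_add_distrib]
        ring
      map_smul' := by
        intro c a
        ext i
        simp only [Prod.smul_fst, Prod.smul_snd, Pi.smul_apply, Submodule.coe_smul, eval_smul,
          smul_eq_mul, RingHom.id_apply, mul_add, Finset.mul_sum, mul_assoc] }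
  have hker : LinearMap.ker φ ≠ ⊥ := by
    apply LinearMap.ker_ne_bot_of_finrank_lt
    rw [hV, Module.finrank_fintype_fun_eq_card]
    exact hcard
  obtain ⟨a, ha, ha0⟩ := Submodule.exists_mem_ne_zero_of_ne_bot hker
  refine ⟨a.1, fun j => a.2 j, mem_degreeLT.1 a.1.2, fun j => mem_degreeLT.1 (a.2 j).2, ?_,
    fun i => congrFun (LinearMap.mem_ker.1 ha) i⟩
  by_contra! h
  apply ha0
  ext1
  · exact Subtype.ext h.1
  · funext j
    exact Subtype.ext (congrFun h.2 j)

open Polynomial in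
/-- A solution of degree at most `d` of a nontrivial functional equation
`∑ j, A j * h (c ^ j * X) = 0` is determined by few of its coefficients. -/
theorem exists_determining_coeffs {F : Type*} [Field F] {s d : ℕ} {c : F}
    (hc : Set.InjOn (fun n : ℕ => c ^ n) (Set.Iic d)) (A : Fin s → F[X]) (hA : A ≠ 0) :
    ∃ J : Finset ℕ, J.card ≤ s - 1 ∧ ∀ h : F[X], h.natDegree ≤ d →
      ∑ j, A j * h.comp (C (c ^ (j : ℕ)) * X) = 0 → (∀ n ∈ J, h.coeff n = 0) → h = 0 := by
  classical
  have hex : ∃ k, ∃ j, (A j).coeff k ≠ 0 := by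
    by_contra! H
    exact hA (funext fun j => Polynomial.ext fun k => by simpa using H k j)
  let k := Nat.find hex
  obtain ⟨j₀, hj₀⟩ : ∃ j, (A j).coeff k ≠ 0 := Nat.find_spec hex
  have hmin : ∀ i < k, ∀ j, (A j).coeff i = 0 := fun i hi j => by
    have := Nat.find_min hex hi
    push Not at this
    exact this j
  -- As `k` is the lowest order occurring in the `A j`, degree `k + n` of the equation reads
  -- `h.coeff n * B(c ^ n)` plus terms in lower coefficients of `h`. Only roots of `B` leave
  -- `h.coeff n` free.
  let B : F[X] := ∑ j : Fin s, C ((A j).coeff k) * X ^ (j : ℕ)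
  have hBc : ∀ j : Fin s, B.coeff j = (A j).coeff k := fun j => by
    simp [B, finsetSum_coeff, coeff_X_pow, Fin.val_inj]
  have hB : B ≠ 0 := fun h => hj₀ (by rw [← hBc, h, coeff_zero])
  have hBdeg : B.natDegree ≤ s - 1 := by
    refine natDegree_sum_le_of_forall_le _ _ fun j _ => (natDegree_C_mul_X_pow_le _ _).trans ?_
    have := j.2
    omega
  refine ⟨(Finset.range (d + 1)).filter fun n => B.eval (c ^ n) = 0, ?_, ?_⟩
  · refine le_trans ?_ hBdeg
    by_contra! hlt
    refine hB (eq_zero_of_natDegree_lt_card_of_eval_eq_zero' B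
      (((Finset.range (d + 1)).filter fun n => B.eval (c ^ n) = 0).image fun n => c ^ n) ?_ ?_)
    · intro x hx
      obtain ⟨n, hn, rfl⟩ := Finset.mem_image.1 hx
      exact (Finset.mem_filter.1 hn).2
    · rwa [Finset.card_image_of_injOn]
      intro x hx y hy hxy
      simp only [Finset.coe_filter, Finset.mem_range, Set.mem_ofPred_eq] at hx hy
      exact hc (by simp; omega) (by simp; omega) hxy
  · intro h hd hsum hJ
    have key : ∀ n, h.coeff n = 0 := by
      intro n
      induction n using Nat.strong_induction_on with
      | _ n ih =>
        by_cases hn : d < n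
        · exact coeff_eq_zero_of_natDegree_lt (by omega)
        by_cases hBn : B.eval (c ^ n) = 0
        · exact hJ n (Finset.mem_filter.2 ⟨by simp; omega, hBn⟩)
        have h1 : ∀ j : Fin s, (A j * h.comp (C (c ^ (j : ℕ)) * X)).coeff (k + n)
            = h.coeff n * ((A j).coeff k * (c ^ n) ^ (j : ℕ)) := by
          intro j
          rw [coeff_mul, Finset.sum_eq_single (k, n)]
          · rw [comp_C_mul_X_coeff]
            ring
          · rintro ⟨p, q⟩ hpq hne
            rw [Finset.HasAntidiagonal.mem_antidiagonal] at hpq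
            dsimp only at hpq ⊢
            rcases lt_trichotomy p k with hp | hp | hp
            · rw [hmin p hp, zero_mul]
            · exact absurd (by ext <;> simp <;> omega) hne
            · rw [comp_C_mul_X_coeff, ih q (by omega), zero_mul, mul_zero]
          · intro hnot
            simp at hnot
        have h2 := congrArg (fun p => p.coeff (k + n)) hsum
        simp only [finsetSum_coeff, h1, coeff_zero, ← Finset.mul_sum] at h2
        refine (mul_eq_zero.1 h2).resolve_right fun h3 => hBn ?_
        simpa [B, eval_finsetSum] using h3
    exact Polynomial.ext key

/-- A space of functions of dimension at most `e` is determined by its values at some `e` points. -/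
theorem Submodule.exists_determining_points {F X : Type*} [Field F] [Nonempty X] (e : ℕ)
    (V : Submodule F (X → F)) [FiniteDimensional F V] (hV : Module.finrank F V ≤ e) :
    ∃ p : Fin e → X, ∀ v ∈ V, (∀ t, v (p t) = 0) → v = 0 := by
  induction e generalizing V with
  | zero =>
    refine ⟨Fin.elim0, fun v hv _ => ?_⟩
    rw [Submodule.finrank_eq_zero.1 (Nat.le_zero.1 hV)] at hv
    exact (Submodule.mem_bot F).1 hv
  | succ e ih =>
    by_cases hbot : V = ⊥
    · exact ⟨fun _ => Classical.arbitrary X, fun v hv _ => by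
        rw [hbot] at hv; exact (Submodule.mem_bot F).1 hv⟩
    obtain ⟨v, hv, hv0⟩ := Submodule.exists_mem_ne_zero_of_ne_bot hbot
    obtain ⟨x, hx⟩ := Function.ne_iff.1 hv0
    -- Some `v` in `V` is nonzero at `x`, so vanishing at `x` lowers the dimension.
    let W := V ⊓ LinearMap.ker (LinearMap.proj x : (X → F) →ₗ[F] F)
    have hlt : W < V := by
      refine lt_of_le_of_ne inf_le_left fun h => hx ?_
      have : v ∈ W := h ▸ hv
      exact this.2
    have : FiniteDimensional F W := Submodule.finiteDimensional_of_le hlt.le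
    obtain ⟨p, hp⟩ := ih W (by have := Submodule.finrank_lt_finrank_of_lt hlt; omega)
    refine ⟨Fin.cons x p, fun w hw h0 => hp w ⟨hw, ?_⟩ fun t => ?_⟩
    · simpa using h0 0
    · simpa using h0 t.succ

open Polynomial in
/-- Solutions of degree at most `d < q` of a nontrivial functional equation
`∑ j, A j * h (c ^ j * X) = 0` are determined by their values at some `s - 1` points. -/
theorem exists_determining_points {F : Type*} [Field F] [Fintype F] {s d : ℕ} {c : F}
    (hc : Set.InjOn (fun n : ℕ => c ^ n) (Set.Iic d)) (hd : d < Fintype.card F)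
    (A : Fin s → F[X]) (hA : A ≠ 0) :
    ∃ p : Fin (s - 1) → F, ∀ h : F[X], h.natDegree ≤ d →
      ∑ j, A j * h.comp (C (c ^ (j : ℕ)) * X) = 0 → (∀ t, h.eval (p t) = 0) → h = 0 := by
  obtain ⟨J, hJ, hdet⟩ := exists_determining_coeffs hc A hA
  let W : Submodule F F[X] :=
    { carrier := {h | h.natDegree ≤ d ∧ ∑ j, A j * h.comp (C (c ^ (j : ℕ)) * X) = 0}
      add_mem' := by
        rintro f g ⟨hf, hf0⟩ ⟨hg, hg0⟩
        refine ⟨natDegree_add_le_of_degree_le hf hg, ?_⟩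
        simp only [add_comp, mul_add, Finset.sum_add_distrib, hf0, hg0, add_zero]
      zero_mem' := by simp
      smul_mem' := by
        rintro a f ⟨hf, hf0⟩
        refine ⟨(natDegree_smul_le a f).trans hf, ?_⟩
        simp only [smul_comp, mul_smul_comm, ← Finset.smul_sum, hf0, smul_zero] }
  let L : W →ₗ[F] (J → F) := LinearMap.pi fun n => lcoeff F n ∘ₗ W.subtype
  have hL : Function.Injective L := by
    rw [← LinearMap.ker_eq_bot, LinearMap.ker_eq_bot']
    intro h hh
    exact Subtype.ext (hdet h h.2.1 h.2.2 fun n hn => congrFun hh ⟨n, hn⟩)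
  have : FiniteDimensional F W := FiniteDimensional.of_injective L hL
  have hW : Module.finrank F W ≤ s - 1 := by
    refine (LinearMap.finrank_le_finrank_of_injective hL).trans ?_
    simpa using hJ
  -- Passing from coefficients to values loses nothing, because `d < q`.
  let E : F[X] →ₗ[F] (F → F) := LinearMap.pi fun x => leval x
  obtain ⟨p, hp⟩ := (W.map E).exists_determining_points (s - 1)
    ((Submodule.finrank_map_le E W).trans hW)
  refine ⟨p, fun h hh hsum h0 => ?_⟩
  have hE := hp (E h) (Submodule.mem_map_of_mem ⟨hh, hsum⟩) h0
  exact eq_zero_of_natDegree_lt_card_of_eval_eq_zero h Function.injective_id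
    (fun x => congrFun hE x) (by omega)

/-! ### List decoding of folded Reed–Solomon codes -/

theorem block_index_lt {m N : ℕ} (i : Fin N) {l : ℕ} (hl : l < m) : m * (i : ℕ) + l < m * N := by
  calc m * (i : ℕ) + l < m * (i : ℕ) + m := by omega
    _ = m * (i + 1) := by ring
    _ ≤ m * N := Nat.mul_le_mul_left _ i.2

theorem eq_and_eq_of_block_index_eq {m i i' l l' : ℕ} (hl : l < m) (hl' : l' < m)
    (h : m * i + l = m * i' + l') : i = i' ∧ l = l' := by
  have hi : i = i' := by
    have := congrArg (· / m) h
    simpa [Nat.mul_add_div (Nat.zero_lt_of_lt hl), Nat.div_eq_of_lt hl,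
      Nat.div_eq_of_lt hl'] using this
  subst hi
  exact ⟨rfl, by omega⟩

open Polynomial in
/-- List decoding of folded Reed-Solomon codes: the polynomials of degree at most `d` that agree
with a word at all but at most `A` of the `n` blocks in `R` are told apart by `s - 1` points. -/
theorem exists_points_separating_candidates {F : Type*} [Field F] [Fintype F] {m N : ℕ} {c : F}
    (hc : IsPrimitiveRoot c (Fintype.card F - 1)) (hcard : m * N < Fintype.card F)
    (z : Fin N → Fin m → F) (R : Finset (Fin N)) {s w d A : ℕ} (hs : 0 < s) (hw : 0 < w)
    (hm : s + w = m + 1)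
    (hA : A * (s + 1) * w + s * (d + m) ≤ s * w * R.card) :
    ∃ p : Fin (s - 1) → F, ∀ f g : F[X], f.natDegree ≤ d → g.natDegree ≤ d →
      (∃ G ⊆ R, R.card ≤ G.card + A ∧ ∀ i ∈ G, ∀ l, z i l = f.eval (c ^ (m * (i : ℕ) + l))) →
      (∃ G ⊆ R, R.card ≤ G.card + A ∧ ∀ i ∈ G, ∀ l, z i l = g.eval (c ^ (m * (i : ℕ) + l))) →
      (∀ t, f.eval (p t) = g.eval (p t)) → f = g := by
  have hdn : d + m ≤ w * R.card := by
    refine (Nat.mul_le_mul_left_iff hs).1 ?_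
    rw [← mul_assoc]
    omega
  have hRN : R.card ≤ N := by simpa using R.card_le_univ
  have hwm : w * R.card ≤ m * N := Nat.mul_le_mul (by omega) hRN
  have hinj : Set.InjOn (fun n : ℕ => c ^ n) (Set.Iio (m * N)) := fun i hi j hj h =>
    hc.pow_inj (by simp at hi; omega) (by simp at hj; omega) h
  -- The largest `D` with `(s + 1) * D + d ≤ w * R.card`: the `(s + 1) * (D + 1) + d` unknowns just
  -- outnumber the constraints, while the degree `D + d` stays below the number of agreeing windows.
  let D := (w * R.card - d) / (s + 1)
  have hD : (s + 1) * D ≤ w * R.card - d := Nat.mul_div_le _ _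
  have hD' : w * R.card - d < (s + 1) * (D + 1) := Nat.lt_mul_div_succ _ (by omega)
  obtain ⟨A₀, B, hA₀, hB, hne, hint⟩ := exists_linear_interpolant (F := F) (ι := R × Fin w) s
    (D + 1 + d) (D + 1) (fun i => c ^ (m * (i.1 : ℕ) + i.2))
    -- A block of length `m` contains `w = m - s + 1` windows of length `s`.
    (fun i j => z i.1 ⟨i.2 + j, by omega⟩) (by
      rw [Fintype.card_prod, Fintype.card_coe, Fintype.card_fin]
      nlinarith [Nat.sub_add_cancel (show d ≤ w * R.card by omega)])
  have hvanish : ∀ f : F[X], f.natDegree ≤ d →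
      (∃ G ⊆ R, R.card ≤ G.card + A ∧ ∀ i ∈ G, ∀ l, z i l = f.eval (c ^ (m * (i : ℕ) + l))) →
      A₀ + ∑ j, B j * f.comp (C (c ^ (j : ℕ)) * X) = 0 := by
    rintro f hf ⟨G, hGR, hG, hagree⟩
    refine eq_zero_of_natDegree_lt_card_of_eval_eq_zero _ (ι := G × Fin w)
      (f := fun i => c ^ (m * (i.1 : ℕ) + i.2)) ?_ ?_ ?_
    · rintro ⟨i, l⟩ ⟨i', l'⟩ h
      have hl : (l : ℕ) < m := by omega
      have hl' : (l' : ℕ) < m := by omega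
      obtain ⟨h2, h3⟩ := eq_and_eq_of_block_index_eq hl hl'
        (hinj (block_index_lt i.1 hl) (block_index_lt i'.1 hl') h)
      exact Prod.ext (Subtype.ext (Fin.ext h2)) (Fin.ext h3)
    · rintro ⟨i, l⟩
      rw [← hint (⟨i, hGR i.2⟩, l), eval_add, eval_finsetSum]
      congr 1
      refine Finset.sum_congr rfl fun j _ => ?_
      rw [hagree i i.2, eval_mul, eval_comp]
      simp only [eval_mul, eval_C, eval_X]
      congr 2
      rw [← pow_add]
      congr 1
      omega
    · have hdeg : (A₀ + ∑ j, B j * f.comp (C (c ^ (j : ℕ)) * X)).natDegree ≤ D + d := by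
        refine natDegree_add_le_of_degree_le ?_ (natDegree_sum_le_of_forall_le _ _ fun j _ => ?_)
        · rw [add_right_comm] at hA₀
          exact natDegree_le_of_degree_le (Order.lt_succ_iff.1 hA₀)
        · refine natDegree_mul_le.trans (add_le_add ?_ ?_)
          · have := hB j
            exact natDegree_le_of_degree_le (Order.lt_succ_iff.1 this)
          · refine natDegree_comp_le.trans ?_
            calc f.natDegree * (C (c ^ (j : ℕ)) * X : F[X]).natDegree ≤ d * 1 :=
                  Nat.mul_le_mul hf (natDegree_C_mul_le _ _ |>.trans natDegree_X_le)
              _ = d := mul_one d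
      refine hdeg.trans_lt ?_
      rw [Fintype.card_prod, Fintype.card_coe, Fintype.card_fin]
      have hd' : w * R.card - d + d = w * R.card := Nat.sub_add_cancel (by omega)
      have h1 : (s + 1) * w * R.card ≤ (s + 1) * w * (G.card + A) := Nat.mul_le_mul_left _ hG
      have h2 : 0 < s * m := by
        have : 0 < m := by omega
        positivity
      refine Nat.lt_of_mul_lt_mul_left (a := s + 1) ?_
      nlinarith
  -- If `B = 0`, a candidate would force `A₀ = 0` too; so there are none and any points do.
  by_cases hB0 : B = 0
  · refine ⟨0, fun f g hf _ hfa _ _ => absurd (hvanish f hf hfa) ?_⟩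
    simpa [hB0] using hne
  obtain ⟨p, hp⟩ := exists_determining_points (s := s) (d := d) (c := c)
    (fun i hi j hj h => hinj (by simp at hi ⊢; omega) (by simp at hj ⊢; omega) h) (by omega) B hB0
  refine ⟨p, fun f g hf hg hfa hga hfg => sub_eq_zero.1 (hp (f - g) ?_ ?_ fun t => ?_)⟩
  · exact (natDegree_sub_le_of_le hf hg).trans (by simp)
  · have h1 := hvanish f hf hfa
    have h2 := hvanish g hg hga
    simp only [sub_comp, mul_sub, Finset.sum_sub_distrib]
    linear_combination h1 - h2
  · rw [eval_sub, hfg t, sub_self]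

/-! ### Lagrange interpolation and uniform laws -/

open Polynomial in
theorem Lagrange.interpolate_eq_of_degree_lt {F ι : Type*} [Field F] [DecidableEq ι]
    {S : Finset ι} {v : ι → F} (hv : Set.InjOn v S) {f : F[X]} (hf : f.degree < S.card) :
    ∑ j ∈ S, C (f.eval (v j)) * Lagrange.basis S v j = f := by
  rw [← Lagrange.interpolate_apply]
  exact (Lagrange.eq_interpolate hv hf).symm

/-- The image of the uniform distribution does not change when the function is precomposed with a
permutation. -/
theorem PMF.map_uniformOfFintype_comp_equiv {α β : Type*} [Fintype α] [Nonempty α]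
    (e : α ≃ α) (f : α → β) :
    (PMF.uniformOfFintype α).map (f ∘ e) = (PMF.uniformOfFintype α).map f := by
  classical
  rw [← PMF.map_comp]
  congr 1
  ext x
  rw [PMF.map_apply, tsum_eq_single (e.symm x)]
  · simp
  · intro y hy
    rw [if_neg]
    rintro rfl
    simp at hy

/-! ### The encoding polynomial and its composition with `g` -/

namespace FLCC

variable {F : Type*} [Field F] [Fintype F] {m N K T D a b a' b' : ℕ}
  (P : FLCC F m N K T D a b a' b')

theorem encode_β (X : Fin (m * K) → Matrix (Fin a) (Fin b) F)
    (Z : Fin (m * T) → Matrix (Fin a) (Fin b) F) (j : Fin (m * K) ⊕ Fin (m * T)) :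
    P.encode X Z (P.β j) = Sum.elim X Z j := by
  classical
  unfold encode
  rw [Finset.sum_eq_single j]
  · rw [Lagrange.eval_basis_self P.β_injective.injOn (Finset.mem_univ j), one_smul]
  · intro i _ hij
    rw [Lagrange.eval_basis_of_ne hij (Finset.mem_univ j), zero_smul]
  · simp

theorem encode_add (X X' : Fin (m * K) → Matrix (Fin a) (Fin b) F)
    (Z Z' : Fin (m * T) → Matrix (Fin a) (Fin b) F) (z : F) :
    P.encode (X + X') (Z + Z') z = P.encode X Z z + P.encode X' Z' z := by
  unfold encode
  rw [← Finset.sum_add_distrib]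
  refine Finset.sum_congr rfl fun j _ => ?_
  rw [← smul_add]
  cases j <;> rfl

open Polynomial in
/-- A polynomial of degree less than the number of interpolation points is an entry of the encoding
of its values at these points. -/
theorem encode_eval (f : Fin a → Fin b → F[X])
    (hf : ∀ i j, (f i j).degree < (m * K + m * T : ℕ)) (z : F) :
    P.encode (fun k => Matrix.of fun i j => (f i j).eval (P.β (Sum.inl k)))
      (fun k => Matrix.of fun i j => (f i j).eval (P.β (Sum.inr k))) z
      = Matrix.of fun i j => (f i j).eval z := by
  classical
  ext i j
  have h := congrArg (eval z) (Lagrange.interpolate_eq_of_degree_lt (S := Finset.univ)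
    (v := P.β) P.β_injective.injOn (f := f i j) (by simpa using hf i j))
  rw [eval_finsetSum] at h
  rw [Matrix.of_apply, ← h]
  unfold encode
  rw [Matrix.sum_apply]
  refine Finset.sum_congr rfl fun k _ => ?_
  rw [Matrix.smul_apply, eval_mul, eval_C, smul_eq_mul, mul_comm]
  congr 1
  cases k <;> simp

open Classical Polynomial in
/-- The entries of the encoding polynomial. -/
noncomputable def encodePoly (X : Fin (m * K) → Matrix (Fin a) (Fin b) F)
    (Z : Fin (m * T) → Matrix (Fin a) (Fin b) F) (p : Fin a × Fin b) : F[X] :=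
  ∑ j : Fin (m * K) ⊕ Fin (m * T), Sum.elim X Z j p.1 p.2 • Lagrange.basis Finset.univ P.β j

theorem eval_encodePoly (X : Fin (m * K) → Matrix (Fin a) (Fin b) F)
    (Z : Fin (m * T) → Matrix (Fin a) (Fin b) F) (p : Fin a × Fin b) (z : F) :
    (P.encodePoly X Z p).eval z = P.encode X Z z p.1 p.2 := by
  unfold encode encodePoly
  rw [Matrix.sum_apply, Polynomial.eval_finsetSum]
  simp [mul_comm]

theorem natDegree_encodePoly_le (X : Fin (m * K) → Matrix (Fin a) (Fin b) F)
    (Z : Fin (m * T) → Matrix (Fin a) (Fin b) F) (p : Fin a × Fin b) :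
    (P.encodePoly X Z p).natDegree ≤ m * K + m * T - 1 := by
  classical
  refine Polynomial.natDegree_sum_le_of_forall_le _ _ fun j _ => ?_
  refine (Polynomial.natDegree_smul_le _ _).trans ?_
  rw [Lagrange.natDegree_basis P.β_injective.injOn (Finset.mem_univ j)]
  simp

/-- The entries of the composed polynomial. -/
noncomputable def composedPoly (X : Fin (m * K) → Matrix (Fin a) (Fin b) F)
    (Z : Fin (m * T) → Matrix (Fin a) (Fin b) F) (i : Fin a') (j : Fin b') : Polynomial F :=
  MvPolynomial.aeval (P.encodePoly X Z) (P.g i j)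

theorem eval_composedPoly (X : Fin (m * K) → Matrix (Fin a) (Fin b) F)
    (Z : Fin (m * T) → Matrix (Fin a) (Fin b) F) (i : Fin a') (j : Fin b') (z : F) :
    (P.composedPoly X Z i j).eval z = P.composed X Z z i j := by
  unfold composedPoly composed apply
  rw [Matrix.of_apply, ← Polynomial.coe_evalRingHom, MvPolynomial.map_aeval]
  simp only [Polynomial.coe_evalRingHom, eval_encodePoly, Polynomial.algebraMap_eq]
  rw [MvPolynomial.eval, show (Polynomial.evalRingHom z).comp Polynomial.C = RingHom.id F by
    ext; simp]

theorem natDegree_composedPoly_le (X : Fin (m * K) → Matrix (Fin a) (Fin b) F)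
    (Z : Fin (m * T) → Matrix (Fin a) (Fin b) F) (i : Fin a') (j : Fin b') :
    (P.composedPoly X Z i j).natDegree ≤ D * (m * K + m * T - 1) :=
  MvPolynomial.aeval_natDegree_le _ (P.g_degree i j) _ (P.natDegree_encodePoly_le X Z)

/-! ### Received words and the decoder -/

theorem Received.map {R R' : Type*} {S A : ℕ} {honest : Fin N → R} {y : Fin N → Option R}
    (h : Received S A honest y) (φ : R → R') :
    Received S A (fun i => φ (honest i)) (fun i => (y i).map φ) := by
  obtain ⟨U, V, hU, hV, h1, h2⟩ := h
  refine ⟨U, V, hU, hV, fun i hi hi' => ?_, fun i hi hi' => ?_⟩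
  · simp [h1 i hi hi']
  · simp [h2 i hi hi']

/-- There are `N - S` workers, depending only on the word received, such that all but at most `A`
of them have answered honestly. -/
theorem Received.exists_card_agree {R : Type*} [Zero R] (S A : ℕ) (y : Fin N → Option R) :
    ∃ Q : Finset (Fin N), Q.card = N - S ∧ ∀ honest : Fin N → R, Received S A honest y →
      ∃ G ⊆ Q, Q.card ≤ G.card + A ∧ ∀ i ∈ G, (y i).getD 0 = honest i := by
  classical
  let Y : Finset (Fin N) := {i | y i ≠ none}
  have hgood : ∀ (honest : Fin N → R) (U V : Finset (Fin N)),
      (∀ i, i ∉ U → i ∉ V → y i = some (honest i)) → (∀ i ∈ U, i ∉ V → y i = none) →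
      ∀ i ∈ Y, i ∉ V → (y i).getD 0 = honest i := by
    intro honest U V h1 h2 i hi hiV
    by_cases hiU : i ∈ U
    · exact absurd (h2 i hiU hiV) (Finset.mem_filter.1 hi).2
    · rw [h1 i hiU hiV, Option.getD_some]
  rcases le_total (N - S) Y.card with hY | hY
  · obtain ⟨Q, hQ, hQc⟩ := Finset.exists_subset_card_eq hY
    refine ⟨Q, hQc, ?_⟩
    rintro honest ⟨U, V, hU, hV, h1, h2⟩
    refine ⟨Q \ V, Finset.sdiff_subset, ?_, fun i hi => ?_⟩
    · have := Finset.le_card_sdiff V Q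
      omega
    · rw [Finset.mem_sdiff] at hi
      exact hgood honest U V h1 h2 i (hQ hi.1) hi.2
  -- Too few answers means that Byzantine workers were silent. Padding with silent workers, read as
  -- `0`, is harmless: at least `N - S - A` honest answers are still there.
  · obtain ⟨Q, hQ, hQc⟩ := Finset.exists_superset_card_eq hY (by simp)
    refine ⟨Q, hQc, ?_⟩
    rintro honest ⟨U, V, hU, hV, h1, h2⟩
    refine ⟨Y \ V, Finset.sdiff_subset.trans hQ, ?_, fun i hi => ?_⟩
    · have h3 : (Finset.univ \ (U ∪ V)) ⊆ Y \ V := by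
        intro i hi
        simp only [Finset.mem_sdiff, Finset.mem_union, not_or, Finset.mem_univ, true_and] at hi
        refine Finset.mem_sdiff.2 ⟨Finset.mem_filter.2 ⟨Finset.mem_univ i, ?_⟩, hi.2⟩
        rw [h1 i hi.1 hi.2]
        exact Option.some_ne_none _
      have h4 := Finset.card_le_card h3
      have h5 := Finset.le_card_sdiff (U ∪ V) Finset.univ
      have h6 := Finset.card_union_le U V
      rw [Finset.card_fin] at h5
      omega
    · rw [Finset.mem_sdiff] at hi
      exact hgood honest U V h1 h2 i hi.1 hi.2

/-- The polynomials of degree at most `d` whose evaluations at the points of the workers can have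
led to the word `y`. -/
def candidates (S A d : ℕ) (y : Fin N → Option (Fin m → F)) : Set (Polynomial F) :=
  {f | f.natDegree ≤ d ∧ Received S A (fun i l => f.eval (P.point i l)) y}

/-- If the candidates for every received word can be told apart by `e` points, then the scheme is
resilient and secure with `e` extra evaluations. -/
theorem isResilientSecure_of_separating {S A e : ℕ}
    (h : ∀ y, ∃ p : Fin e → F, ∀ f ∈ P.candidates S A (D * (m * K + m * T - 1)) y,
      ∀ g ∈ P.candidates S A (D * (m * K + m * T - 1)) y,
      (∀ t, f.eval (p t) = g.eval (p t)) → f = g) :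
    P.IsResilientSecure S A e := by
  classical
  choose p hp using h
  refine ⟨⟨p, fun y v n =>
    -- The default `0` never occurs on an admissible word, since the true polynomial is a candidate.
    if hf : ∃ f ∈ P.candidates S A (D * (m * K + m * T - 1)) y, ∀ t, f.eval (p y t) = v t then
      hf.choose.eval (P.β (Sum.inl n)) else 0⟩, ?_⟩
  intro X Z y hy i j n
  set w := entryWord y i j with hw
  have hmem : P.composedPoly X Z i j ∈ P.candidates S A (D * (m * K + m * T - 1)) w := by
    refine ⟨P.natDegree_composedPoly_le X Z i j, ?_⟩
    simp only [eval_composedPoly]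
    exact hy.map fun M l => M l i j
  have hex : ∃ f ∈ P.candidates S A (D * (m * K + m * T - 1)) w,
      ∀ t, f.eval (p w t) = P.composed X Z (p w t) i j :=
    ⟨_, hmem, fun t => P.eval_composedPoly X Z i j _⟩
  have heq : hex.choose = P.composedPoly X Z i j :=
    hp w _ hex.choose_spec.1 _ hmem fun t => by
      rw [hex.choose_spec.2 t, eval_composedPoly]
  change (if hf : ∃ f ∈ P.candidates S A (D * (m * K + m * T - 1)) w,
    ∀ t, f.eval (p w t) = P.composed X Z (p w t) i j then
      hf.choose.eval (P.β (Sum.inl n)) else 0) = _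
  rw [dif_pos hex, heq, eval_composedPoly, composed, encode_β, Sum.elim_inl]

theorem isResilientSecure_of_le {S A s w : ℕ} (hs : 0 < s) (hw : 0 < w) (hm : s + w = m + 1)
    (hA : A * (s + 1) * w + s * (D * (m * K + m * T - 1) + m) ≤ s * w * (N - S)) :
    P.IsResilientSecure S A (s - 1) := by
  refine P.isResilientSecure_of_separating fun y => ?_
  obtain ⟨Q, hQ, hagree⟩ := Received.exists_card_agree S A y
  obtain ⟨p, hp⟩ := exists_points_separating_candidates P.primitive P.card_lt
    (fun i => (y i).getD 0) Q hs hw hm (hQ ▸ hA)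
  refine ⟨p, fun f hf g hg hfg => hp f g hf.1 hg.1 ?_ ?_ hfg⟩
  · obtain ⟨G, hG, hcard, hG'⟩ := hagree _ hf.2
    exact ⟨G, hG, hcard, fun i hi l => congrFun (hG' i hi) l⟩
  · obtain ⟨G, hG, hcard, hG'⟩ := hagree _ hg.2
    exact ⟨G, hG, hcard, fun i hi l => congrFun (hG' i hi) l⟩

/-! ### Privacy -/

theorem point_injective :
    Function.Injective fun p : Fin N × Fin m => P.point p.1 p.2 := by
  rintro ⟨i, l⟩ ⟨i', l'⟩ h
  have hq := P.card_lt
  have h1 := P.primitive.pow_inj ((block_index_lt i l.2).trans_le (by omega))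
    ((block_index_lt i' l'.2).trans_le (by omega)) h
  obtain ⟨h2, h3⟩ := eq_and_eq_of_block_index_eq l.2 l'.2 h1
  exact Prod.ext (Fin.ext h2) (Fin.ext h3)

theorem point_ne_β (i : Fin N) (l : Fin m) (j : Fin (m * K) ⊕ Fin (m * T)) :
    P.point i l ≠ P.β j := by
  exact P.disjoint _ (block_index_lt i l.2) j

/-- The change of the data from `0` to `X` can be hidden from `T` workers by a change of masks. -/
theorem exists_masks_share_eq_zero (C : Finset (Fin N)) (hC : C.card ≤ T)
    (X : Fin (m * K) → Matrix (Fin a) (Fin b) F) :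
    ∃ W : Fin (m * T) → Matrix (Fin a) (Fin b) F,
      ∀ i ∈ C, ∀ l, P.encode X W (P.point i l) = 0 := by
  classical
  let v : Fin (m * K) ⊕ (C × Fin m) → F := Sum.elim (fun k => P.β (Sum.inl k))
    fun p => P.point p.1 p.2
  have hv : Function.Injective v := by
    refine Function.Injective.sumElim (P.β_injective.comp Sum.inl_injective) ?_
      fun k p h => P.point_ne_β _ _ _ h.symm
    rintro ⟨i, l⟩ ⟨i', l'⟩ h
    have h' := P.point_injective (a₁ := ((i : Fin N), l)) (a₂ := ((i' : Fin N), l')) h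
    rw [Prod.mk.injEq] at h'
    exact Prod.ext (Subtype.ext h'.1) h'.2
  -- Prescribe the data at the data points and `0` at the points of `C`. These are at most `m * K +
  -- m * T` conditions, so the interpolant is an encoding; its values at the mask points are `W`.
  let f : Fin a → Fin b → Polynomial F := fun i j =>
    Lagrange.interpolate Finset.univ v (Sum.elim (fun k => X k i j) fun _ => 0)
  have hfv : ∀ i j k, (f i j).eval (v k) = Sum.elim (fun k => X k i j) (fun _ => 0) k :=
    fun i j k => Lagrange.eval_interpolate_at_node _ hv.injOn (Finset.mem_univ k)
  have hf : ∀ i j, (f i j).degree < (m * K + m * T : ℕ) := fun i j => by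
    refine (Lagrange.degree_interpolate_lt _ hv.injOn).trans_le ?_
    rw [Nat.cast_le, Finset.card_univ, Fintype.card_sum, Fintype.card_prod, Fintype.card_coe,
      Fintype.card_fin, Fintype.card_fin, mul_comm C.card]
    exact Nat.add_le_add_left (Nat.mul_le_mul_left _ hC) _
  refine ⟨fun k => Matrix.of fun i j => (f i j).eval (P.β (Sum.inr k)), fun w hw l => ?_⟩
  have hX : X = fun k => Matrix.of fun i j => (f i j).eval (P.β (Sum.inl k)) := by
    funext k
    ext i j
    exact (hfv i j (Sum.inl k)).symm
  have h := P.encode_eval f hf (P.point w l)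
  rw [← hX] at h
  rw [h]
  ext i j
  exact hfv i j (Sum.inr (⟨w, hw⟩, l))

/-- By linearity, translating the masks by `W` turns the shares in `C` for data `X'` into those for
`X`. -/
theorem isPrivate : P.IsPrivate T := by
  classical
  intro C hC X X'
  obtain ⟨W, hW⟩ := P.exists_masks_share_eq_zero C hC (X - X')
  unfold shareLaw
  rw [← PMF.map_uniformOfFintype_comp_equiv (Equiv.addRight W)]
  congr 1
  funext Z w l
  change P.encode X (Z + W) (P.point w l) = P.encode X' Z (P.point w l)
  conv_lhs => rw [← add_sub_cancel X' X]
  rw [encode_add, hW w w.2 l, add_zero]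

end FLCC

/-! ### Arithmetic of the security bound -/

/-- The bound on the number of Byzantine workers, with denominators cleared. -/
theorem flcc_security_bound {m N K T S D A s : ℕ} (hK : 0 < K) (hS : S < N) (hs : 1 ≤ s)
    (hsm : s ≤ m)
    (hA : (A : ℝ) / ((N : ℝ) - S) ≤ flccBound m (flccRate m N K T S D) s) :
    A * (s + 1) * (m - s + 1) + s * (D * (m * K + m * T - 1) + m)
      ≤ s * (m - s + 1) * (N - S) := by
  have hm : 1 ≤ m := hs.trans hsm
  have hn : (0 : ℝ) < (N : ℝ) - S := sub_pos.2 (by exact_mod_cast hS)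
  have hw : (0 : ℝ) < (m : ℝ) - s + 1 := by
    have : (s : ℝ) ≤ m := by exact_mod_cast hsm
    linarith
  have hm0 : (m : ℝ) ≠ 0 := by positivity
  have hs1 : (0 : ℝ) < (s : ℝ) + 1 := by positivity
  -- Makes the truncated subtraction in the degree bound a genuine one.
  have h1 : 1 ≤ m * K + m * T := by nlinarith [Nat.mul_pos hm hK]
  rw [← Nat.cast_le (α := ℝ)]
  push_cast [Nat.cast_sub hsm, Nat.cast_sub hS.le, Nat.cast_sub h1]
  unfold flccBound flccRate at hA
  rw [div_le_iff₀ hn] at hA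
  have h2 := mul_le_mul_of_nonneg_right hA (mul_pos hs1 hw).le
  have h3 : (s : ℝ) / (s + 1) * (1 - m * ((((K : ℝ) + T - 1 / m) * D + 1) / ((N : ℝ) - S))
      / ((m : ℝ) - s + 1)) * ((N : ℝ) - S) * ((s + 1) * ((m : ℝ) - s + 1))
      = s * ((m : ℝ) - s + 1) * ((N : ℝ) - S) - s * (D * (m * K + m * T - 1) + m) := by
    field_simp
  rw [h3] at h2
  linarith

theorem theorem3 {F : Type*} [Field F] [Fintype F] {m N K T D a b a' b' : ℕ}
    (P : FLCC F m N K T D a b a' b') (hK : 0 < K)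
    (S A s : ℕ) (hS : S < N)
    (hs : IsFLCCSStar m (flccRate m N K T S D) s)
    (hA : (A : ℝ) / ((N : ℝ) - S) ≤ flccBound m (flccRate m N K T S D) s) :
    P.IsResilientSecure S A (s - 1) ∧ P.IsPrivate T := by
  obtain ⟨⟨hs1, hsm, -⟩, -⟩ := hs
  exact ⟨P.isResilientSecure_of_le hs1 (Nat.succ_pos (m - s)) (by omega)
    (flcc_security_bound hK hS hs1 hsm hA), P.isPrivate⟩
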